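/- All vector spaces are real. A Banach sequence lattice $Y$ is a linear subspace of $\mathbb{R}^{\mathbb{N}}$ that contains every canonical sequence $e_k$, equipped with a complete norm such that, if $g\in Y$ and $f\in\mathbb{R}^{\mathbb{N}}$ satisfy $|f|\le|g|$ pointwise, then $f\in Y$ and $\|f\|_Y\le\|g\|_Y$; for $t\in\mathbb{R}^n$ put $\|t\|_{\mathbb{R}^n,Y}:=\|(t_1,\dots,t_n,0,0,\dots)\|_Y$. Let $\mathcal{H}_n$ be the vector space of continuous functions $h:\mathbb{R}^n\to\mathbb{R}$ with $h(\lambda t)=\lambda h(t)$ for all $\lambda\ge 0$ and $t\in\mathbb{R}^n$. Let $X$ be a Banach lattice, $Y$ a Banach sequence lattice and $n\in\mathbb{N}$. For every $x=(x_1,\dots,x_n)\in X^n$ there is a unique linear map $\tau_{n,x}:\mathcal{H}_n\to X$ (Krivine's functional calculus) that sends the $j$-th coordinate function $t\mapsto t_j$ to $x_j$ for $1\le j\le n$ and satisfies $\tau_{n,x}(h_1\vee h_2)=\tau_{n,x}(h_1)\vee\tau_{n,x}(h_2)$ for all $h_1,h_2\in\mathcal{H}_n$. For $x\in X^n$ put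 $$\|x\|_{X^n,Y,\tau}:=\big\|\tau_{n,x}(\|\cdot\|_{\mathbb{R}^n,Y})\big\|_X,\qquad \|x\|_{X^n,1}:=\sum_{j=1}^n\|x_j\|_X,\qquad \|x\|_{X^n,Y}:=\big\|(\|x_1\|_X,\dots,\|x_n\|_X)\big\|_{\mathbb{R}^n,Y}.$$ Then (i) $\|\cdot\|_{X^n,Y,\tau}$ is equivalent to $\|\cdot\|_{X^n,1}$, i.e. there are constants $c,C>0$ with $c\|x\|_{X^n,1}\le\|x\|_{X^n,Y,\tau}\le C\|x\|_{X^n,1}$ for all $x\in X^n$; (ii) $\|\cdot\|_{X^n,Y,\tau}$ is a norm on $X^n$, and $X^n$ with this norm and the componentwise order is a Banach lattice (the norm is order-preserving, i.e. $|x|\le|z|$ implies $\|x\|_{X^n,Y,\tau}\le\|z\|_{X^n,Y,\tau}$, and complete); (iii) $\|\cdot\|_{X^n,Y,\tau}$ is equivalent, in the same sense, to $\|\cdot\|_{X^n,Y}$. -/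

import Mathlib

noncomputable section

/-- `N` is a norm on the real vector space `V` that makes `V` a Banach space. -/
structure IsBanachNorm {V : Type*} [AddCommGroup V] [Module ℝ V] (N : V → ℝ) : Prop where
  nonneg : ∀ v, 0 ≤ N v
  eq_zero_iff : ∀ v, N v = 0 ↔ v = 0
  smul : ∀ (c : ℝ) v, N (c • v) = |c| * N v
  add_le : ∀ u v, N (u + v) ≤ N u + N v
  /-- every Cauchy sequence converges -/
  complete : ∀ u : ℕ → V,
    (∀ ε > 0, ∃ K, ∀ m ≥ K, ∀ k ≥ K, N (u m - u k) < ε) →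
    ∃ v, ∀ ε > 0, ∃ K, ∀ m ≥ K, N (u m - v) < ε

/-- `N` is an order-preserving norm on the Riesz space `V` that makes `V` a Banach lattice. -/
structure IsBanachLatticeNorm {V : Type*} [AddCommGroup V] [Lattice V] [IsOrderedAddMonoid V]
    [Module ℝ V] [PosSMulMono ℝ V] (N : V → ℝ) : Prop extends IsBanachNorm N where
  solid : ∀ u v, |u| ≤ |v| → N u ≤ N v

/-- A Banach sequence lattice: an order ideal of the space of all real sequences that contains
every canonical sequence and is a Banach space for an order-preserving norm. -/
structure BanachSequenceLattice where
  /-- the underlying vector space of sequences -/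
  space : Submodule ℝ (ℕ → ℝ)
  /-- the norm -/
  norm : space → ℝ
  /-- the space is a Banach space -/
  isBanachNorm : IsBanachNorm norm
  /-- the ideal property, with an order-preserving norm -/
  solid : ∀ (f : ℕ → ℝ) (g : space), (∀ k, |f k| ≤ |(g : ℕ → ℝ) k|) →
    ∃ hf : f ∈ space, norm ⟨f, hf⟩ ≤ norm g
  /-- the canonical sequences belong to the space -/
  single_mem : ∀ k : ℕ, (Pi.single k 1 : ℕ → ℝ) ∈ space

/-- The sequence `(t₁, …, tₙ, 0, 0, …)`, as a linear function of `(t₁, …, tₙ)`. -/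
def extendByZero (n : ℕ) : (Fin n → ℝ) →ₗ[ℝ] (ℕ → ℝ) where
  toFun t := fun k => if h : k < n then t ⟨k, h⟩ else 0
  map_add' s t := by
    funext k
    by_cases h : k < n <;> simp [h]
  map_smul' c t := by
    funext k
    by_cases h : k < n <;> simp [h]

namespace BanachSequenceLattice

theorem extendByZero_mem (Y : BanachSequenceLattice) (n : ℕ) (t : Fin n → ℝ) :
    extendByZero n t ∈ Y.space := by
  have h : extendByZero n t = ∑ j : Fin n, t j • (Pi.single (j : ℕ) 1 : ℕ → ℝ) := by
    funext k
    simp only [extendByZero, LinearMap.coe_mk, AddHom.coe_mk, Finset.sum_apply, Pi.smul_apply,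
      Pi.single_apply, smul_eq_mul, mul_ite, mul_one, mul_zero]
    by_cases hk : k < n
    · rw [dif_pos hk, Finset.sum_eq_single (⟨k, hk⟩ : Fin n)]
      · simp
      · intro b _ hb
        rw [if_neg]
        rintro rfl
        exact hb rfl
      · simp
    · rw [dif_neg hk]
      symm
      apply Finset.sum_eq_zero
      intro j _
      rw [if_neg]
      have := j.2
      omega
  rw [h]
  exact Submodule.sum_mem _ fun j _ => Submodule.smul_mem _ _ (Y.single_mem j)

/-- The inclusion of `ℝⁿ` into a Banach sequence lattice. -/
def incl (Y : BanachSequenceLattice) (n : ℕ) : (Fin n → ℝ) →ₗ[ℝ] Y.space :=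
  (extendByZero n).codRestrict Y.space (Y.extendByZero_mem n)

/-- The norm `‖·‖_{ℝⁿ,Y}`. -/
def finNorm (Y : BanachSequenceLattice) (n : ℕ) (t : Fin n → ℝ) : ℝ := Y.norm (Y.incl n t)

end BanachSequenceLattice

/-- The space `𝓗ₙ` of continuous functions `ℝⁿ → ℝ` that are homogeneous of degree 1. -/
def HomFun (n : ℕ) : Submodule ℝ ((Fin n → ℝ) → ℝ) where
  carrier := {h | Continuous h ∧ ∀ c : ℝ, 0 ≤ c → ∀ t, h (c • t) = c * h t}
  add_mem' := by
    rintro f g ⟨hf, hf'⟩ ⟨hg, hg'⟩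
    refine ⟨hf.add hg, fun c hc t => ?_⟩
    simp only [Pi.add_apply, hf' c hc, hg' c hc]
    ring
  zero_mem' := ⟨continuous_const, fun c _ t => by simp⟩
  smul_mem' := by
    rintro a f ⟨hf, hf'⟩
    refine ⟨hf.const_smul a, fun c hc t => ?_⟩
    simp only [Pi.smul_apply, hf' c hc, smul_eq_mul]
    ring

namespace HomFun

/-- The coordinate function `π_{n,j}`. -/
def proj {n : ℕ} (j : Fin n) : HomFun n :=
  ⟨fun t => t j, continuous_apply j, fun c _ t => by simp⟩

/-- The pointwise maximum of two elements of `𝓗ₙ`. -/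
def sup {n : ℕ} (f g : HomFun n) : HomFun n :=
  ⟨fun t => max ((f : (Fin n → ℝ) → ℝ) t) ((g : (Fin n → ℝ) → ℝ) t),
    f.2.1.max g.2.1, fun c hc t => by
      change max _ _ = c * max _ _
      rw [f.2.2 c hc, g.2.2 c hc, mul_max_of_nonneg _ _ hc]⟩

end HomFun

theorem BanachSequenceLattice.finNorm_smul (Y : BanachSequenceLattice) (n : ℕ) (c : ℝ)
    (t : Fin n → ℝ) : Y.finNorm n (c • t) = |c| * Y.finNorm n t := by
  simp only [BanachSequenceLattice.finNorm, map_smul, Y.isBanachNorm.smul]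

theorem BanachSequenceLattice.continuous_finNorm (Y : BanachSequenceLattice) (n : ℕ) :
    Continuous (Y.finNorm n) := by
  have h : ConvexOn ℝ Set.univ (Y.finNorm n) := by
    refine ⟨convex_univ, fun s _ t _ a b ha hb _ => ?_⟩
    have h1 : Y.finNorm n (a • s + b • t) ≤ Y.finNorm n (a • s) + Y.finNorm n (b • t) := by
      simp only [BanachSequenceLattice.finNorm, map_add]
      exact Y.isBanachNorm.add_le _ _
    rw [Y.finNorm_smul, Y.finNorm_smul, abs_of_nonneg ha, abs_of_nonneg hb] at h1
    exact h1
  exact h.locallyLipschitz.continuous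

/-- The norm `‖·‖_{ℝⁿ,Y}` as an element of `𝓗ₙ`. -/
def BanachSequenceLattice.normHomFun (Y : BanachSequenceLattice) (n : ℕ) : HomFun n :=
  ⟨Y.finNorm n, Y.continuous_finNorm n, fun c hc t => by
    rw [Y.finNorm_smul, abs_of_nonneg hc]⟩

section Krivine

variable {X : Type*} [NormedAddCommGroup X] [Lattice X] [NormedSpace ℝ X]

/-- The defining properties of Krivine's functional calculus `τ_{n,x} : 𝓗ₙ → X`: a linear map
with `τ(π_{n,j}) = x_j` that preserves finite suprema. -/
structure IsKrivineCalculus {n : ℕ} (x : Fin n → X) (τ : HomFun n →ₗ[ℝ] X) : Prop where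
  map_proj : ∀ j, τ (HomFun.proj j) = x j
  map_sup : ∀ f g, τ (HomFun.sup f g) = τ f ⊔ τ g

open Classical in
/-- Krivine's functional calculus `τ_{n,x}`: the linear map singled out by `IsKrivineCalculus`
(and `0` if there were none). -/
def krivine {n : ℕ} (x : Fin n → X) : HomFun n →ₗ[ℝ] X :=
  if h : ∃ τ, IsKrivineCalculus x τ then h.choose else 0

/-- `‖x‖_{Xⁿ,Y,τ} = ‖τ_{n,x}(‖·‖_{ℝⁿ,Y})‖_X`. -/
def tauNorm (Y : BanachSequenceLattice) {n : ℕ} (x : Fin n → X) : ℝ :=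
  ‖krivine x (Y.normHomFun n)‖

end Krivine

/-- `‖x‖_{Xⁿ,1} = ∑ ‖x_j‖_X`. -/
def ellOneNorm {X : Type*} [NormedAddCommGroup X] {n : ℕ} (x : Fin n → X) : ℝ :=
  ∑ j, ‖x j‖

/-- `‖x‖_{Xⁿ,Y} = ‖(‖x₁‖_X, …, ‖xₙ‖_X)‖_Y`. -/
def seqNorm (Y : BanachSequenceLattice) {X : Type*} [NormedAddCommGroup X] {n : ℕ}
    (x : Fin n → X) : ℝ :=
  Y.finNorm n fun j => ‖x j‖

/-- Equivalence of two (norm) functions. -/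
def NormEquivalent {V : Type*} (N M : V → ℝ) : Prop :=
  ∃ c C : ℝ, 0 < c ∧ 0 < C ∧ ∀ v, c * M v ≤ N v ∧ N v ≤ C * M v

end

/-!
Krivine's functional calculus is built from a finite inequality. In the vector lattice
`ℝ^(ℝⁿ) × X`, consider the vector sublattice generated by the pairs of the `j`-th coordinate
function and `x j`. Its elements are differences of finite suprema of linear combinations of these
pairs (`generatedSublattice`). If such an element has a nonnegative first component, then its second
component is nonnegative as well: this reduces to the case of an inequality `a ≤ sup_b b` between
linear functionals on `ℝⁿ`, and there the separation theorem shows that `a` is a convex combination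
of the functionals `b`, so that the inequality holds for the corresponding vectors of `X`
(`coordPair_snd_le_of_fst_le`, `snd_nonneg_of_mem_generatedSublattice`).

The closure of this sublattice for uniform convergence relative to `(∑ |t j|, ∑ |x j|)` is again a
vector sublattice with this positivity property, hence the graph of a linear lattice homomorphism.
It is defined on all of `𝓗ₙ` by the lattice version of the Stone–Weierstrass theorem and the
completeness of `X` (`exists_mem_krivineGraph`). The graph of any functional calculus contains the
sublattice and, the calculus being monotone, is contained in the closure, whence uniqueness
(`IsKrivineCalculus.unique`).

Uniqueness makes the calculus compatible with substitution of homogeneous functions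
(`krivine_subst`). Inequalities for `‖·‖_{ℝⁿ,Y}` therefore transfer to `X`. The bounds
`‖e_j‖ |t_j| ≤ ‖t‖ ≤ ∑ ‖e_j‖ |t_j|` give the equivalence of `tauNorm Y` and `seqNorm Y` with the
`ℓ¹`-norm, and with it completeness. The triangle inequality and monotonicity of the norm are
inequalities in `2n` variables, to which the calculus for `2n` vectors applies.
-/

noncomputable section

/-! ### Sublattices and relatively uniform closures -/

section VectorLattice

variable {V W : Type*} [AddCommGroup V] [Module ℝ V] [AddCommGroup W] [Lattice W]
  [Module ℝ W]

theorem smul_sup_of_nonneg [PosSMulMono ℝ W] {c : ℝ} (hc : 0 ≤ c) (u v : W) :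
    c • (u ⊔ v) = c • u ⊔ c • v := by
  rcases hc.eq_or_lt with rfl | hc
  · simp
  · exact (OrderIso.smulRight (β := W) hc).map_sup u v

/-- The finite suprema of vectors `φ a`. -/
def linearSups (φ : V →ₗ[ℝ] W) : Set W := supClosure (Set.range φ)

theorem map_mem_linearSups (φ : V →ₗ[ℝ] W) (a : V) : φ a ∈ linearSups φ :=
  subset_supClosure ⟨a, rfl⟩

theorem sup_mem_linearSups {φ : V →ₗ[ℝ] W} {p q : W} (hp : p ∈ linearSups φ)
    (hq : q ∈ linearSups φ) : p ⊔ q ∈ linearSups φ :=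
  supClosed_supClosure hp hq

/-- To prove a property of all finite suprema of vectors `φ a`, it suffices to prove it for these
vectors and to show that it is inherited by binary suprema. -/
theorem linearSups_induction {φ : V →ₗ[ℝ] W} {P : W → Prop} (hmap : ∀ a, P (φ a))
    (hsup : ∀ p q, P p → P q → P (p ⊔ q)) {p : W} (hp : p ∈ linearSups φ) : P p :=
  supClosure_min (t := {p | P p}) (by rintro _ ⟨a, rfl⟩; exact hmap a)
    (fun p hp q hq => hsup p q hp hq) hp

theorem exists_finset_sup'_eq_of_mem_linearSups {φ : V →ₗ[ℝ] W} {p : W}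
    (hp : p ∈ linearSups φ) : ∃ (B : Finset V) (hB : B.Nonempty), p = B.sup' hB φ := by
  classical
  refine linearSups_induction
    (P := fun p => ∃ (B : Finset V) (hB : B.Nonempty), p = B.sup' hB φ)
    (fun a => ⟨{a}, Finset.singleton_nonempty a, by simp⟩) ?_ hp
  rintro _ _ ⟨A, hA, rfl⟩ ⟨B, hB, rfl⟩
  exact ⟨A ∪ B, hA.mono Finset.subset_union_left, (Finset.sup'_union hA hB φ).symm⟩

theorem add_mem_linearSups [IsOrderedAddMonoid W] {φ : V →ₗ[ℝ] W} {p q : W} (hp : p ∈ linearSups φ)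
    (hq : q ∈ linearSups φ) : p + q ∈ linearSups φ := by
  refine linearSups_induction (P := fun p => p + q ∈ linearSups φ) (fun a => ?_)
    (fun p p' h h' => ?_) hp
  · refine linearSups_induction (P := fun q => φ a + q ∈ linearSups φ) (fun b => ?_)
      (fun q q' h h' => ?_) hq
    · rw [← map_add]
      exact map_mem_linearSups φ _
    · rw [add_sup]
      exact sup_mem_linearSups h h'
  · rw [sup_add]
    exact sup_mem_linearSups h h'

theorem smul_mem_linearSups [PosSMulMono ℝ W] {φ : V →ₗ[ℝ] W} {p : W}
    (hp : p ∈ linearSups φ) {c : ℝ} (hc : 0 ≤ c) : c • p ∈ linearSups φ := by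
  refine linearSups_induction (P := fun p => c • p ∈ linearSups φ) (fun a => ?_)
    (fun p q h h' => ?_) hp
  · rw [← map_smul]
    exact map_mem_linearSups φ _
  · rw [smul_sup_of_nonneg hc]
    exact sup_mem_linearSups h h'

variable [IsOrderedAddMonoid W] [PosSMulMono ℝ W]

/-- The vector sublattice generated by the range of a linear map `φ`, as the set of differences of
finite suprema of vectors `φ a`. -/
def generatedSublattice (φ : V →ₗ[ℝ] W) : Submodule ℝ W where
  carrier := {w | ∃ p ∈ linearSups φ, ∃ q ∈ linearSups φ, w = p - q}
  zero_mem' := ⟨φ 0, map_mem_linearSups φ 0, φ 0, map_mem_linearSups φ 0, by simp⟩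
  add_mem' := by
    rintro _ _ ⟨p, hp, q, hq, rfl⟩ ⟨p', hp', q', hq', rfl⟩
    exact ⟨p + p', add_mem_linearSups hp hp', q + q', add_mem_linearSups hq hq', by abel⟩
  smul_mem' := by
    rintro c _ ⟨p, hp, q, hq, rfl⟩
    rcases le_total 0 c with hc | hc
    · exact ⟨c • p, smul_mem_linearSups hp hc, c • q, smul_mem_linearSups hq hc, smul_sub _ _ _⟩
    · have hc' : 0 ≤ -c := neg_nonneg.2 hc
      refine ⟨(-c) • q, smul_mem_linearSups hq hc', (-c) • p, smul_mem_linearSups hp hc', ?_⟩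
      simp only [neg_smul, smul_sub]
      abel

theorem map_mem_generatedSublattice (φ : V →ₗ[ℝ] W) (a : V) : φ a ∈ generatedSublattice φ :=
  ⟨φ a, map_mem_linearSups φ a, φ 0, map_mem_linearSups φ 0, by simp⟩

theorem sup_mem_generatedSublattice {φ : V →ₗ[ℝ] W} {v w : W} (hv : v ∈ generatedSublattice φ)
    (hw : w ∈ generatedSublattice φ) : v ⊔ w ∈ generatedSublattice φ := by
  obtain ⟨p, hp, q, hq, rfl⟩ := hv
  obtain ⟨p', hp', q', hq', rfl⟩ := hw
  -- `(p - q) ⊔ (p' - q') = (p + q') ⊔ (p' + q) - (q + q')`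
  refine ⟨(p + q') ⊔ (p' + q),
    sup_mem_linearSups (add_mem_linearSups hp hq') (add_mem_linearSups hp' hq),
    q + q', add_mem_linearSups hq hq', ?_⟩
  rw [sup_sub]
  congr 1 <;> abel

theorem abs_mem_generatedSublattice {φ : V →ₗ[ℝ] W} {w : W} (hw : w ∈ generatedSublattice φ) :
    |w| ∈ generatedSublattice φ :=
  sup_mem_generatedSublattice hw (Submodule.neg_mem _ hw)

theorem inf_mem_generatedSublattice {φ : V →ₗ[ℝ] W} {v w : W} (hv : v ∈ generatedSublattice φ)
    (hw : w ∈ generatedSublattice φ) : v ⊓ w ∈ generatedSublattice φ := by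
  have h := Submodule.neg_mem _ (sup_mem_generatedSublattice (Submodule.neg_mem _ hv)
    (Submodule.neg_mem _ hw))
  rwa [neg_sup, neg_neg, neg_neg] at h

/-- The generated sublattice is the least one: it lies in every subspace that is closed under
suprema and contains the range of `φ`. -/
theorem generatedSublattice_le {φ : V →ₗ[ℝ] W} {S : Submodule ℝ W} (hmap : ∀ a, φ a ∈ S)
    (hsup : ∀ v ∈ S, ∀ w ∈ S, v ⊔ w ∈ S) : generatedSublattice φ ≤ S := by
  have h : ∀ p ∈ linearSups φ, p ∈ S := fun p hp =>
    linearSups_induction (P := (· ∈ S)) hmap (fun p q hp hq => hsup p hp q hq) hp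
  rintro _ ⟨p, hp, q, hq, rfl⟩
  exact S.sub_mem (h p hp) (h q hq)

/-- The closure of a subspace `G` for uniform convergence relative to the positive element `e`. -/
def relUniformClosure (G : Submodule ℝ W) (e : W) (he : 0 ≤ e) : Submodule ℝ W where
  carrier := {w | ∀ ε : ℝ, 0 < ε → ∃ g ∈ G, w ≤ g + ε • e ∧ g ≤ w + ε • e}
  zero_mem' := fun ε hε => ⟨0, G.zero_mem, by simpa using smul_nonneg hε.le he,
    by simpa using smul_nonneg hε.le he⟩
  add_mem' := by
    intro v w hv hw ε hε
    obtain ⟨g, hg, hvg, hgv⟩ := hv (ε / 2) (half_pos hε)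
    obtain ⟨k, hk, hwk, hkw⟩ := hw (ε / 2) (half_pos hε)
    have hε' : ε • e = (ε / 2) • e + (ε / 2) • e := by rw [← add_smul, add_halves]
    refine ⟨g + k, G.add_mem hg hk, ?_, ?_⟩
    · rw [hε', add_add_add_comm]
      exact add_le_add hvg hwk
    · rw [hε', add_add_add_comm]
      exact add_le_add hgv hkw
  smul_mem' := by
    intro c w hw ε hε
    have hc : 0 < |c| + 1 := by positivity
    obtain ⟨g, hg, hwg, hgw⟩ := hw (ε / (|c| + 1)) (by positivity)
    have hle : |c| • (ε / (|c| + 1)) • e ≤ ε • e := by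
      have h1 : 0 ≤ (ε - |c| * (ε / (|c| + 1))) • e := by
        refine smul_nonneg ?_ he
        rw [sub_nonneg, mul_div_assoc', div_le_iff₀ hc]
        nlinarith
      rwa [sub_smul, sub_nonneg, mul_smul] at h1
    refine ⟨c • g, G.smul_mem c hg, ?_⟩
    have h1 := smul_le_smul_of_nonneg_left hwg (abs_nonneg c)
    have h2 := smul_le_smul_of_nonneg_left hgw (abs_nonneg c)
    rw [smul_add] at h1 h2
    have h3 := h1.trans (add_le_add_right hle _)
    have h4 := h2.trans (add_le_add_right hle _)
    rcases le_total 0 c with h | h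
    · rw [abs_of_nonneg h] at h3 h4
      exact ⟨h3, h4⟩
    · rw [abs_of_nonpos h, neg_smul, neg_smul] at h3 h4
      rw [neg_le_iff_add_nonneg] at h3 h4
      constructor
      · rw [← sub_nonneg]
        exact h4.trans_eq (by abel)
      · rw [← sub_nonneg]
        exact h3.trans_eq (by abel)

theorem sup_mem_relUniformClosure {G : Submodule ℝ W} {e : W} {he : 0 ≤ e}
    (hG : ∀ v ∈ G, ∀ w ∈ G, v ⊔ w ∈ G) {v w : W} (hv : v ∈ relUniformClosure G e he)
    (hw : w ∈ relUniformClosure G e he) : v ⊔ w ∈ relUniformClosure G e he := by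
  intro ε hε
  obtain ⟨g, hg, hvg, hgv⟩ := hv ε hε
  obtain ⟨k, hk, hwk, hkw⟩ := hw ε hε
  refine ⟨g ⊔ k, hG g hg k hk, ?_, ?_⟩
  · rw [sup_add]
    exact sup_le_sup hvg hwk
  · rw [sup_add]
    exact sup_le_sup hgv hkw

theorem le_relUniformClosure (G : Submodule ℝ W) {e : W} (he : 0 ≤ e) :
    G ≤ relUniformClosure G e he := fun w hw _ hε =>
  ⟨w, hw, le_add_of_nonneg_right (smul_nonneg hε.le he),
    le_add_of_nonneg_right (smul_nonneg hε.le he)⟩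

end VectorLattice

/-! ### Lattice-linear functions and their values in `X` -/

section KrivineGraph

variable {X : Type*} [NormedAddCommGroup X] [NormedSpace ℝ X]

/-- The linear map from `ℝⁿ` to the vector lattice `ℝ^(ℝⁿ) × X` that sends the `j`-th basis vector
to the pair of the `j`-th coordinate function and `x j`. -/
def coordPair {n : ℕ} (x : Fin n → X) : (Fin n → ℝ) →ₗ[ℝ] ((Fin n → ℝ) → ℝ) × X :=
  Fintype.linearCombination ℝ fun j => (fun t => t j, x j)

theorem coordPair_fst {n : ℕ} (x : Fin n → X) (a t : Fin n → ℝ) :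
    (coordPair x a).1 t = ∑ j, a j * t j := by
  simp [coordPair, Fintype.linearCombination_apply, Prod.fst_sum]

theorem coordPair_snd {n : ℕ} (x : Fin n → X) (a : Fin n → ℝ) :
    (coordPair x a).2 = ∑ j, a j • x j := by
  simp [coordPair, Fintype.linearCombination_apply, Prod.snd_sum]

theorem coordPair_single {n : ℕ} (x : Fin n → X) (j : Fin n) :
    coordPair x (Pi.single j 1) = (fun t => t j, x j) := by
  simp [coordPair, Fintype.linearCombination_apply_single]

variable [Lattice X]

/-- The pair of the function `t ↦ ∑ |t j|` and the vector `∑ |x j|`. -/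
def absSumPair {n : ℕ} (x : Fin n → X) : ((Fin n → ℝ) → ℝ) × X :=
  ∑ j, |coordPair x (Pi.single j 1)|

theorem absSumPair_fst {n : ℕ} (x : Fin n → X) (t : Fin n → ℝ) :
    (absSumPair x).1 t = ∑ j, |t j| := by
  simp only [absSumPair, Prod.fst_sum, Finset.sum_apply, coordPair_single]
  rfl

variable [IsOrderedAddMonoid X]

theorem absSumPair_nonneg {n : ℕ} (x : Fin n → X) : 0 ≤ absSumPair x :=
  Finset.sum_nonneg fun _ _ => abs_nonneg _

variable [IsOrderedModule ℝ X]

/-- An inequality between a linear functional and a finite supremum of linear functionals passes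
from `ℝⁿ` to `X`: by the separation theorem, such a functional lies in the convex hull of the
others. -/
theorem coordPair_snd_le_of_fst_le {n : ℕ} {x : Fin n → X} {a : Fin n → ℝ}
    {q : ((Fin n → ℝ) → ℝ) × X} (hq : q ∈ linearSups (coordPair x))
    (h : (coordPair x a).1 ≤ q.1) : (coordPair x a).2 ≤ q.2 := by
  obtain ⟨B, hB, rfl⟩ := exists_finset_sup'_eq_of_mem_linearSups hq
  have ha : a ∈ convexHull ℝ (B : Set (Fin n → ℝ)) := by
    by_contra hna
    obtain ⟨f, u, hfB, hfa⟩ := geometric_hahn_banach_closed_point (convex_convexHull ℝ _)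
      (B.finite_toSet.isClosed_convexHull (𝕜 := ℝ)) hna
    -- the point of `ℝⁿ` that represents the separating functional `f`
    have hrep : ∀ b : Fin n → ℝ, (coordPair x b).1 (fun j => f (Pi.single j 1)) = f b := by
      intro b
      rw [coordPair_fst]
      conv_rhs => rw [pi_eq_sum_univ' b]
      simp [map_sum]
    have h1 := h fun j => f (Pi.single j 1)
    rw [hrep] at h1
    have h2 : (B.sup' hB (coordPair x)).1 ≤ fun t => B.sup' hB fun b => (coordPair x b).1 t := by
      have : B.sup' hB (coordPair x) ≤ (fun t => B.sup' hB fun b => (coordPair x b).1 t,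
          (B.sup' hB (coordPair x)).2) := by
        refine Finset.sup'_le _ _ fun b hb => ⟨fun t => ?_, (Finset.le_sup' (coordPair x) hb).2⟩
        exact Finset.le_sup' (fun b => (coordPair x b).1 t) hb
      exact this.1
    have h3 : f a ≤ B.sup' hB fun b => (coordPair x b).1 fun j => f (Pi.single j 1) :=
      h1.trans (h2 _)
    obtain ⟨b, hb, hbe⟩ := Finset.exists_mem_eq_sup' hB
      fun b => (coordPair x b).1 (fun j => f (Pi.single j 1))
    rw [hbe, hrep] at h3
    exact absurd (hfB b (subset_convexHull ℝ _ hb)) (not_lt.2 (hfa.le.trans h3))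
  have hconv : Convex ℝ {b : Fin n → ℝ | (coordPair x b).2 ≤ (B.sup' hB (coordPair x)).2} :=
    (convex_Iic (B.sup' hB (coordPair x)).2).linear_preimage
      ((LinearMap.snd ℝ _ X).comp (coordPair x))
  exact convexHull_min (fun b hb => (Finset.le_sup' (coordPair x) hb).2) hconv ha

/-- Lattice-linear inequalities pass from `ℝⁿ` to `X`. -/
theorem snd_nonneg_of_mem_generatedSublattice {n : ℕ} {x : Fin n → X}
    {g : ((Fin n → ℝ) → ℝ) × X} (hg : g ∈ generatedSublattice (coordPair x)) (h : 0 ≤ g.1) :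
    0 ≤ g.2 := by
  obtain ⟨p, hp, q, hq, rfl⟩ := hg
  have key : q.1 ≤ p.1 → q.2 ≤ p.2 := by
    refine linearSups_induction (P := fun q => q.1 ≤ p.1 → q.2 ≤ p.2) (fun a h => ?_)
      (fun q q' h h' hle => ?_) hq
    · exact coordPair_snd_le_of_fst_le hp h
    · exact sup_le (h (le_sup_left.trans hle)) (h' (le_sup_right.trans hle))
  exact sub_nonneg.2 (key (sub_nonneg.1 h))

theorem fst_mem_homFun_of_mem_generatedSublattice {n : ℕ} {x : Fin n → X}
    {g : ((Fin n → ℝ) → ℝ) × X} (hg : g ∈ generatedSublattice (coordPair x)) :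
    g.1 ∈ HomFun n := by
  refine generatedSublattice_le (S := (HomFun n).comap (LinearMap.fst ℝ _ X)) (fun a => ?_)
    (fun v hv w hw => ?_) hg
  · have h : (coordPair x a).1 = ∑ j, a j • ((HomFun.proj j : HomFun n) : (Fin n → ℝ) → ℝ) := by
      funext t
      simp [coordPair_fst, HomFun.proj]
    change (coordPair x a).1 ∈ HomFun n
    rw [h]
    exact Submodule.sum_mem _ fun j _ => Submodule.smul_mem _ _ (HomFun.proj j).2
  · have hv' : v.1 ∈ HomFun n := hv
    have hw' : w.1 ∈ HomFun n := hw
    exact (HomFun.sup ⟨v.1, hv'⟩ ⟨w.1, hw'⟩).2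

theorem absSumPair_mem_generatedSublattice {n : ℕ} (x : Fin n → X) :
    absSumPair x ∈ generatedSublattice (coordPair x) :=
  Submodule.sum_mem _ fun _ _ => abs_mem_generatedSublattice (map_mem_generatedSublattice _ _)

/-- Every `h ∈ 𝓗ₙ` is approximated by lattice-linear functions, uniformly with respect to
`t ↦ ∑ |t j|`. This is the lattice version of the Stone–Weierstrass theorem on the unit sphere. -/
theorem exists_mem_generatedSublattice_approx {n : ℕ} (x : Fin n → X) (h : HomFun n) {ε : ℝ}
    (hε : 0 < ε) : ∃ g ∈ generatedSublattice (coordPair x),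
      ∀ t, |(h : (Fin n → ℝ) → ℝ) t - g.1 t| ≤ ε * ∑ j, |t j| := by
  let K : Set (Fin n → ℝ) := {t | ∑ j, |t j| = 1}
  have hKc : IsCompact K := by
    refine Metric.isCompact_of_isClosed_isBounded
      (isClosed_eq (by fun_prop) continuous_const) ?_
    refine (Metric.isBounded_closedBall (x := (0 : Fin n → ℝ)) (r := 1)).subset fun t ht => ?_
    rw [mem_closedBall_zero_iff, pi_norm_le_iff_of_nonneg zero_le_one]
    intro j
    have ht' : ∑ j, |t j| = 1 := ht
    rw [Real.norm_eq_abs, ← ht']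
    exact Finset.single_le_sum (f := fun j => |t j|) (fun _ _ => abs_nonneg _) (Finset.mem_univ j)
  have : CompactSpace K := isCompact_iff_compactSpace.1 hKc
  let L : Set C(K, ℝ) := {f | ∃ g ∈ generatedSublattice (coordPair x), ∀ t : K, f t = g.1 t}
  have hL : closure L = ⊤ := by
    refine ContinuousMap.sublattice_closure_eq_top L ⟨0, 0, Submodule.zero_mem _, fun t => rfl⟩
      ?_ ?_ ?_
    · rintro f ⟨g, hg, hfg⟩ f' ⟨g', hg', hfg'⟩
      refine ⟨g ⊓ g', inf_mem_generatedSublattice hg hg', fun t => ?_⟩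
      rw [ContinuousMap.inf_apply, hfg, hfg']
      rfl
    · rintro f ⟨g, hg, hfg⟩ f' ⟨g', hg', hfg'⟩
      refine ⟨g ⊔ g', sup_mem_generatedSublattice hg hg', fun t => ?_⟩
      rw [ContinuousMap.sup_apply, hfg, hfg']
      rfl
    · intro v s t
      -- `∑ |t j|` is constant on the sphere, so it suffices to have one coordinate that separates
      have hcomb : ∀ (α β : ℝ) (j : Fin n), ∃ f ∈ L, ∀ r : K, f r = α + β * (r : Fin n → ℝ) j := by
        intro α β j
        refine ⟨⟨fun r => α + β * (r : Fin n → ℝ) j,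
            continuous_const.add (continuous_const.mul
              ((continuous_apply j).comp continuous_subtype_val))⟩,
          ⟨α • absSumPair x + β • coordPair x (Pi.single j 1), ?_, fun r => ?_⟩, fun r => rfl⟩
        · exact Submodule.add_mem _
            (Submodule.smul_mem _ _ (absSumPair_mem_generatedSublattice x))
            (Submodule.smul_mem _ _ (map_mem_generatedSublattice _ _))
        · have hr : ∑ j, |(r : Fin n → ℝ) j| = 1 := r.2
          simp [coordPair_single, absSumPair_fst, hr]
      by_cases hst : s = t
      · subst hst
        rcases n with _ | n
        · exact absurd s.2 (by simp [K])
        · obtain ⟨f, hf, hfe⟩ := hcomb (v s) 0 0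
          exact ⟨f, hf, by simp [hfe], by simp [hfe]⟩
      · obtain ⟨j, hj⟩ := Function.ne_iff.1 (fun he => hst (Subtype.ext he))
        have hj' : (s : Fin n → ℝ) j - (t : Fin n → ℝ) j ≠ 0 := sub_ne_zero.2 hj
        obtain ⟨f, hf, hfe⟩ := hcomb
          (v s - (v s - v t) / ((s : Fin n → ℝ) j - (t : Fin n → ℝ) j) * (s : Fin n → ℝ) j)
          ((v s - v t) / ((s : Fin n → ℝ) j - (t : Fin n → ℝ) j)) j
        refine ⟨f, hf, by rw [hfe]; ring, ?_⟩
        rw [hfe]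
        field_simp
        ring
  let hK : C(K, ℝ) := ⟨fun t => (h : (Fin n → ℝ) → ℝ) t, h.2.1.comp continuous_subtype_val⟩
  have hmem : hK ∈ closure L := hL ▸ Set.mem_univ hK
  obtain ⟨f, ⟨g, hg, hfg⟩, hdist⟩ := Metric.mem_closure_iff.1 hmem ε hε
  refine ⟨g, hg, fun t => ?_⟩
  have hgh := fst_mem_homFun_of_mem_generatedSublattice hg
  have hr0 : 0 ≤ ∑ j, |t j| := Finset.sum_nonneg fun _ _ => abs_nonneg _
  rcases hr0.eq_or_lt with hr | hr
  · have ht : t = 0 := by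
      funext j
      have := (Finset.sum_eq_zero_iff_of_nonneg (fun j _ => abs_nonneg (t j))).1 hr.symm j
        (Finset.mem_univ j)
      simpa using this
    have h1 := h.2.2 0 le_rfl 0
    have h2 := hgh.2 0 le_rfl 0
    rw [zero_smul, zero_mul] at h1 h2
    simp [ht, h1, h2]
  · set r := ∑ j, |t j| with hrdef
    have hs : r⁻¹ • t ∈ K := by
      change ∑ j, |(r⁻¹ • t) j| = 1
      simp only [Pi.smul_apply, smul_eq_mul, abs_mul, abs_of_pos (inv_pos.2 hr)]
      rw [← Finset.mul_sum, ← hrdef, inv_mul_cancel₀ hr.ne']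
    have hclose := (ContinuousMap.dist_lt_iff hε).1 hdist ⟨r⁻¹ • t, hs⟩
    rw [hfg, Real.dist_eq] at hclose
    have ht : t = r • (r⁻¹ • t) := by rw [smul_smul, mul_inv_cancel₀ hr.ne', one_smul]
    rw [ht, h.2.2 r hr.le, hgh.2 r hr.le, ← mul_sub, abs_mul, abs_of_pos hr, mul_comm]
    exact mul_le_mul_of_nonneg_right hclose.le hr.le

end KrivineGraph

/-! ### Existence and uniqueness of the functional calculus -/

section KrivineCalculus

variable {X : Type*} [NormedAddCommGroup X] [Lattice X] [NormedSpace ℝ X]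

namespace IsKrivineCalculus

variable {n : ℕ} {x : Fin n → X} {τ : HomFun n →ₗ[ℝ] X}

theorem map_nonneg (hτ : IsKrivineCalculus x τ) {h : HomFun n}
    (hh : ∀ t, 0 ≤ (h : (Fin n → ℝ) → ℝ) t) : 0 ≤ τ h := by
  have h1 : HomFun.sup h 0 = h := Subtype.ext (funext fun t => max_eq_left (hh t))
  have h2 := hτ.map_sup h 0
  rw [h1, map_zero] at h2
  exact h2 ▸ le_sup_right

theorem mono [IsOrderedAddMonoid X] (hτ : IsKrivineCalculus x τ) {f h : HomFun n}
    (hfh : ∀ t, (f : (Fin n → ℝ) → ℝ) t ≤ (h : (Fin n → ℝ) → ℝ) t) : τ f ≤ τ h := by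
  rw [← sub_nonneg, ← map_sub]
  exact hτ.map_nonneg fun t => sub_nonneg.2 (hfh t)

end IsKrivineCalculus

theorem nonneg_of_forall_pos_nonneg_add_smul [IsOrderedAddMonoid X] [HasSolidNorm X]
    {v e : X} (h : ∀ ε : ℝ, 0 < ε → 0 ≤ v + ε • e) :
    0 ≤ v := by
  have hlim : Filter.Tendsto (fun ε : ℝ => v + ε • e) (nhdsWithin 0 (Set.Ioi 0)) (nhds v) := by
    have hc : Continuous fun ε : ℝ => v + ε • e := by fun_prop
    simpa using (hc.tendsto 0).mono_left nhdsWithin_le_nhds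
  exact ge_of_tendsto hlim (by filter_upwards [self_mem_nhdsWithin] with ε hε using h ε hε)

variable [IsOrderedAddMonoid X] [IsOrderedModule ℝ X]

/-- The graph of Krivine's functional calculus, as the relatively uniform closure of the graph of
its restriction to the lattice-linear functions. -/
def krivineGraph {n : ℕ} (x : Fin n → X) : Submodule ℝ (((Fin n → ℝ) → ℝ) × X) :=
  relUniformClosure (generatedSublattice (coordPair x)) (absSumPair x) (absSumPair_nonneg x)

theorem sup_mem_krivineGraph {n : ℕ} {x : Fin n → X} {v w : ((Fin n → ℝ) → ℝ) × X}
    (hv : v ∈ krivineGraph x) (hw : w ∈ krivineGraph x) : v ⊔ w ∈ krivineGraph x :=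
  sup_mem_relUniformClosure (fun _ hv _ hw => sup_mem_generatedSublattice hv hw) hv hw

/-- A functional calculus for `x` agrees with the lattice-linear one on lattice-linear functions. -/
theorem IsKrivineCalculus.apply_fst_eq_snd {n : ℕ} {x : Fin n → X} {τ : HomFun n →ₗ[ℝ] X}
    (hτ : IsKrivineCalculus x τ) {g : ((Fin n → ℝ) → ℝ) × X}
    (hg : g ∈ generatedSublattice (coordPair x)) (hg1 : g.1 ∈ HomFun n) :
    τ ⟨g.1, hg1⟩ = g.2 := by
  have h : generatedSublattice (coordPair x) ≤
      LinearMap.range ((HomFun n).subtype.prod τ) := by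
    refine generatedSublattice_le (fun a => ⟨∑ j, a j • HomFun.proj j, ?_⟩) ?_
    · refine Prod.ext (funext fun t => ?_) ?_
      · simp [coordPair_fst, HomFun.proj, Prod.fst_sum]
      · simp [coordPair_snd, hτ.map_proj, Prod.snd_sum]
    · rintro _ ⟨f, rfl⟩ _ ⟨f', rfl⟩
      exact ⟨HomFun.sup f f', Prod.ext rfl (hτ.map_sup f f')⟩
  obtain ⟨f, rfl⟩ := h hg
  rfl

theorem IsKrivineCalculus.mem_krivineGraph {n : ℕ} {x : Fin n → X} {τ : HomFun n →ₗ[ℝ] X}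
    (hτ : IsKrivineCalculus x τ) (h : HomFun n) :
    ((h : (Fin n → ℝ) → ℝ), τ h) ∈ krivineGraph x := by
  intro ε hε
  obtain ⟨g, hg, hclose⟩ := exists_mem_generatedSublattice_approx x h hε
  have hE := absSumPair_mem_generatedSublattice x
  let g' : HomFun n := ⟨g.1, fst_mem_homFun_of_mem_generatedSublattice hg⟩
  let E' : HomFun n := ⟨(absSumPair x).1, fst_mem_homFun_of_mem_generatedSublattice hE⟩
  have hτg : τ g' = g.2 := hτ.apply_fst_eq_snd hg _
  have hτE : τ E' = (absSumPair x).2 := hτ.apply_fst_eq_snd hE _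
  have h1 : ∀ t, (h : (Fin n → ℝ) → ℝ) t ≤ g.1 t + ε * (absSumPair x).1 t := fun t => by
    have := (abs_le.1 (hclose t)).2
    rw [absSumPair_fst]
    linarith
  have h2 : ∀ t, g.1 t ≤ (h : (Fin n → ℝ) → ℝ) t + ε * (absSumPair x).1 t := fun t => by
    have := (abs_le.1 (hclose t)).1
    rw [absSumPair_fst]
    linarith
  refine ⟨g, hg, ⟨h1, ?_⟩, ⟨h2, ?_⟩⟩
  · have := hτ.mono (f := h) (h := g' + ε • E') h1
    rwa [map_add, map_smul, hτg, hτE] at this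
  · have := hτ.mono (f := g') (h := h + ε • E') h2
    rwa [map_add, map_smul, hτg, hτE] at this

/-- If two lattice-linear functions are close relative to `∑ |t j|`, then so are the corresponding
vectors of `X` relative to `∑ |x j|`. -/
theorem snd_le_add_of_mem_generatedSublattice {n : ℕ} {x : Fin n → X}
    {g k : ((Fin n → ℝ) → ℝ) × X} (hg : g ∈ generatedSublattice (coordPair x))
    (hk : k ∈ generatedSublattice (coordPair x)) {ε : ℝ}
    (h : ∀ t, g.1 t - k.1 t ≤ ε * ∑ j, |t j|) : g.2 ≤ k.2 + ε • (absSumPair x).2 := by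
  have h1 : 0 ≤ (k + ε • absSumPair x - g).2 := by
    refine snd_nonneg_of_mem_generatedSublattice (Submodule.sub_mem _ (Submodule.add_mem _ hk
      (Submodule.smul_mem _ _ (absSumPair_mem_generatedSublattice x))) hg) fun t => ?_
    have := h t
    simp only [Prod.fst_sub, Prod.fst_add, Prod.smul_fst, Pi.sub_apply, Pi.add_apply,
      Pi.smul_apply, absSumPair_fst, smul_eq_mul, Pi.zero_apply]
    linarith
  exact sub_nonneg.1 h1

theorem coordPair_mem_krivineGraph {n : ℕ} (x : Fin n → X) (a : Fin n → ℝ) :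
    coordPair x a ∈ krivineGraph x :=
  le_relUniformClosure _ _ (map_mem_generatedSublattice _ a)

variable [HasSolidNorm X]

/-- Positivity passes from the lattice-linear functions to the closure, since the positive cone of
`X` is closed. -/
theorem snd_nonneg_of_mem_krivineGraph {n : ℕ} {x : Fin n → X} {w : ((Fin n → ℝ) → ℝ) × X}
    (hw : w ∈ krivineGraph x) (h : 0 ≤ w.1) : 0 ≤ w.2 := by
  refine nonneg_of_forall_pos_nonneg_add_smul (e := (absSumPair x).2) fun ε hε => ?_
  obtain ⟨g, hg, hwg, hgw⟩ := hw (ε / 2) (half_pos hε)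
  have h1 : 0 ≤ (g + (ε / 2) • absSumPair x).2 := by
    refine snd_nonneg_of_mem_generatedSublattice (Submodule.add_mem _ hg
      (Submodule.smul_mem _ _ (absSumPair_mem_generatedSublattice x))) ?_
    exact h.trans hwg.1
  have h2 : (g + (ε / 2) • absSumPair x).2 ≤
      (w + (ε / 2) • absSumPair x + (ε / 2) • absSumPair x).2 := add_le_add_left hgw.2 _
  refine (h1.trans h2).trans_eq ?_
  simp only [Prod.snd_add, Prod.smul_snd]
  rw [add_assoc, ← add_smul, add_halves]

theorem snd_eq_of_mem_krivineGraph {n : ℕ} {x : Fin n → X} {f : (Fin n → ℝ) → ℝ} {v w : X}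
    (hv : (f, v) ∈ krivineGraph x) (hw : (f, w) ∈ krivineGraph x) : v = w := by
  have key : ∀ {v w : X}, (f, v) ∈ krivineGraph x → (f, w) ∈ krivineGraph x → v ≤ w :=
    fun hv hw => sub_nonneg.1 (snd_nonneg_of_mem_krivineGraph (Submodule.sub_mem _ hw hv)
      (by simp))
  exact le_antisymm (key hv hw) (key hw hv)

/-- The calculus is defined on all of `𝓗ₙ`: the values at lattice-linear approximations with errors
`2⁻ᵏ ∑ |t j|` form a Cauchy sequence in `X`, because lattice-linear inequalities pass to `X`. -/
theorem exists_mem_krivineGraph [CompleteSpace X] {n : ℕ} (x : Fin n → X) (h : HomFun n) :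
    ∃ v, ((h : (Fin n → ℝ) → ℝ), v) ∈ krivineGraph x := by
  have hpos : ∀ k : ℕ, (0 : ℝ) < (1 / 2) ^ k := fun k => by positivity
  choose g hg hclose using fun k => exists_mem_generatedSublattice_approx x h (hpos k)
  set e := (absSumPair x).2 with he
  have he0 : 0 ≤ e := (absSumPair_nonneg x).2
  have hbound : ∀ N m : ℕ, N ≤ m → ∀ t,
      |(g m).1 t - (g N).1 t| ≤ (2 * (1 / 2) ^ N : ℝ) * ∑ j, |t j| := by
    intro N m hNm t
    have hm := abs_le.1 (hclose m t)
    have hN := abs_le.1 (hclose N t)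
    have hpow : ((1 / 2 : ℝ) ^ m) * ∑ j, |t j| ≤ ((1 / 2 : ℝ) ^ N) * ∑ j, |t j| :=
      mul_le_mul_of_nonneg_right (pow_le_pow_of_le_one (by norm_num) (by norm_num) hNm)
        (Finset.sum_nonneg fun _ _ => abs_nonneg _)
    rw [abs_le]
    constructor <;> linarith
  have hle : ∀ N m : ℕ, N ≤ m → (g m).2 ≤ (g N).2 + (2 * (1 / 2) ^ N : ℝ) • e :=
    fun N m hNm => snd_le_add_of_mem_generatedSublattice (hg m) (hg N)
      fun t => (abs_le.1 (hbound N m hNm t)).2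
  have hge : ∀ N m : ℕ, N ≤ m → (g N).2 ≤ (g m).2 + (2 * (1 / 2) ^ N : ℝ) • e :=
    fun N m hNm => snd_le_add_of_mem_generatedSublattice (hg N) (hg m) fun t => by
      have := (abs_le.1 (hbound N m hNm t)).1
      linarith
  have hlim0 : Filter.Tendsto (fun N : ℕ => (2 * (1 / 2) ^ N : ℝ)) Filter.atTop (nhds 0) := by
    simpa using (tendsto_pow_atTop_nhds_zero_of_lt_one (r := (1 / 2 : ℝ)) (by norm_num)
      (by norm_num)).const_mul 2
  have hcauchy : CauchySeq fun k => (g k).2 := by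
    refine cauchySeq_of_le_tendsto_0' (fun N => (2 * (1 / 2) ^ N : ℝ) * ‖e‖) (fun N m hNm => ?_)
      (by simpa using hlim0.mul_const ‖e‖)
    have h2 : (0 : ℝ) ≤ 2 * (1 / 2) ^ N := by positivity
    rw [dist_eq_norm, ← norm_smul_of_nonneg h2]
    refine norm_le_norm_of_abs_le_abs ?_
    rw [abs_of_nonneg (smul_nonneg h2 he0), abs_le']
    refine ⟨sub_le_iff_le_add'.2 (hge N m hNm), ?_⟩
    rw [neg_sub]
    exact sub_le_iff_le_add'.2 (hle N m hNm)
  obtain ⟨v, hv⟩ := cauchySeq_tendsto_of_complete hcauchy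
  refine ⟨v, fun ε hε => ?_⟩
  obtain ⟨N, hN⟩ := (hlim0.eventually (gt_mem_nhds hε)).exists
  have hN' : (2 * (1 / 2) ^ N : ℝ) • e ≤ ε • e := by
    rw [← sub_nonneg, ← sub_smul]
    exact smul_nonneg (sub_nonneg.2 hN.le) he0
  have hpow : ∀ t : Fin n → ℝ, (1 / 2 : ℝ) ^ N * ∑ j, |t j| ≤ ε * ∑ j, |t j| := fun t => by
    refine mul_le_mul_of_nonneg_right ?_ (Finset.sum_nonneg fun _ _ => abs_nonneg _)
    have := hpos N
    linarith
  refine ⟨g N, hg N, ⟨fun t => ?_, ?_⟩, ⟨fun t => ?_, ?_⟩⟩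
  · have := (abs_le.1 (hclose N t)).2
    have := hpow t
    simp only [Prod.fst_add, Prod.smul_fst, Pi.add_apply, Pi.smul_apply, absSumPair_fst,
      smul_eq_mul]
    linarith
  · refine le_of_tendsto hv ?_
    filter_upwards [Filter.eventually_ge_atTop N] with m hm
    exact (hle N m hm).trans (add_le_add_right hN' _)
  · have := (abs_le.1 (hclose N t)).1
    have := hpow t
    simp only [Prod.fst_add, Prod.smul_fst, Pi.add_apply, Pi.smul_apply, absSumPair_fst,
      smul_eq_mul]
    linarith
  · refine ge_of_tendsto (hv.add_const (ε • e)) ?_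
    filter_upwards [Filter.eventually_ge_atTop N] with m hm
    exact (hge N m hm).trans (add_le_add_right hN' _)

theorem exists_isKrivineCalculus [CompleteSpace X] {n : ℕ} (x : Fin n → X) :
    ∃ τ, IsKrivineCalculus x τ := by
  choose τ hτ using exists_mem_krivineGraph x
  refine ⟨⟨⟨τ, fun f h => ?_⟩, fun c h => ?_⟩, fun j => ?_, fun f h => ?_⟩
  · exact snd_eq_of_mem_krivineGraph (hτ (f + h)) (Submodule.add_mem _ (hτ f) (hτ h))
  · exact snd_eq_of_mem_krivineGraph (hτ (c • h)) (Submodule.smul_mem _ c (hτ h))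
  · have h := coordPair_mem_krivineGraph x (Pi.single j 1)
    rw [coordPair_single] at h
    exact snd_eq_of_mem_krivineGraph (hτ (HomFun.proj j)) h
  · exact snd_eq_of_mem_krivineGraph (hτ (HomFun.sup f h)) (sup_mem_krivineGraph (hτ f) (hτ h))

theorem IsKrivineCalculus.unique {n : ℕ} {x : Fin n → X} {τ τ' : HomFun n →ₗ[ℝ] X}
    (hτ : IsKrivineCalculus x τ) (hτ' : IsKrivineCalculus x τ') : τ = τ' :=
  LinearMap.ext fun h => snd_eq_of_mem_krivineGraph (hτ.mem_krivineGraph h) (hτ'.mem_krivineGraph h)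

theorem isKrivineCalculus_krivine [CompleteSpace X] {n : ℕ} (x : Fin n → X) :
    IsKrivineCalculus x (krivine x) := by
  rw [krivine, dif_pos (exists_isKrivineCalculus x)]
  exact (exists_isKrivineCalculus x).choose_spec

end KrivineCalculus

/-! ### Substitution in the functional calculus -/

namespace HomFun

/-- The modulus of a homogeneous function. -/
def modulus {n : ℕ} (f : HomFun n) : HomFun n := sup f (-f)

theorem modulus_apply {n : ℕ} (f : HomFun n) (t : Fin n → ℝ) :
    (modulus f : (Fin n → ℝ) → ℝ) t = |(f : (Fin n → ℝ) → ℝ) t| := rfl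

/-- Substitution of the homogeneous functions `T j` of `m` variables into a homogeneous function of
`n` variables. -/
def subst {m n : ℕ} (T : Fin n → HomFun m) : HomFun n →ₗ[ℝ] HomFun m where
  toFun h := ⟨fun t => (h : (Fin n → ℝ) → ℝ) fun j => (T j : (Fin m → ℝ) → ℝ) t,
    h.2.1.comp (continuous_pi fun j => (T j).2.1), fun c hc t => by
      rw [← h.2.2 c hc]
      exact congrArg _ (funext fun j => (T j).2.2 c hc t)⟩
  map_add' _ _ := rfl
  map_smul' _ _ := rfl

end HomFun

section Calculus

variable {X : Type*} [NormedAddCommGroup X] [Lattice X] [NormedSpace ℝ X]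

theorem IsKrivineCalculus.map_modulus {n : ℕ} {x : Fin n → X} {τ : HomFun n →ₗ[ℝ] X}
    (hτ : IsKrivineCalculus x τ) (f : HomFun n) : τ (HomFun.modulus f) = |τ f| := by
  rw [HomFun.modulus, hτ.map_sup, map_neg]
  rfl

theorem IsKrivineCalculus.comp_subst {m n : ℕ} {y : Fin m → X} {τ : HomFun m →ₗ[ℝ] X}
    (hτ : IsKrivineCalculus y τ) (T : Fin n → HomFun m) :
    IsKrivineCalculus (fun j => τ (T j)) (τ ∘ₗ HomFun.subst T) :=
  ⟨fun _ => rfl, fun f g => hτ.map_sup (HomFun.subst T f) (HomFun.subst T g)⟩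

variable [IsOrderedAddMonoid X] [HasSolidNorm X] [IsOrderedModule ℝ X] [CompleteSpace X]

/-- The functional calculus is compatible with substitution. -/
theorem krivine_subst {m n : ℕ} (y : Fin m → X) (T : Fin n → HomFun m) (h : HomFun n) :
    krivine y (HomFun.subst T h) = krivine (fun j => krivine y (T j)) h :=
  LinearMap.congr_fun (((isKrivineCalculus_krivine y).comp_subst T).unique
    (isKrivineCalculus_krivine _)) h

theorem krivine_append_left {n : ℕ} (u v : Fin n → X) (h : HomFun n) :
    krivine (Fin.append u v) (HomFun.subst (fun j => HomFun.proj (Fin.castAdd n j)) h) =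
      krivine u h := by
  rw [krivine_subst]
  simp only [(isKrivineCalculus_krivine _).map_proj, Fin.append_left]

theorem krivine_append_right {n : ℕ} (u v : Fin n → X) (h : HomFun n) :
    krivine (Fin.append u v) (HomFun.subst (fun j => HomFun.proj (Fin.natAdd n j)) h) =
      krivine v h := by
  rw [krivine_subst]
  simp only [(isKrivineCalculus_krivine _).map_proj, Fin.append_right]

end Calculus

/-! ### The norm of `Y` on `ℝⁿ` -/

namespace BanachSequenceLattice

variable (Y : BanachSequenceLattice) (n : ℕ)

theorem finNorm_nonneg (t : Fin n → ℝ) : 0 ≤ Y.finNorm n t := Y.isBanachNorm.nonneg _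

theorem finNorm_add_le (s t : Fin n → ℝ) :
    Y.finNorm n (s + t) ≤ Y.finNorm n s + Y.finNorm n t := by
  simp only [finNorm, map_add]
  exact Y.isBanachNorm.add_le _ _

variable {n}

theorem finNorm_mono {s t : Fin n → ℝ} (h : ∀ j, |s j| ≤ |t j|) :
    Y.finNorm n s ≤ Y.finNorm n t := by
  obtain ⟨_, hle⟩ := Y.solid (extendByZero n s) (Y.incl n t) fun k => by
    change |if h : k < n then s ⟨k, h⟩ else 0| ≤ |if h : k < n then t ⟨k, h⟩ else 0|
    by_cases hk : k < n
    · simpa only [dif_pos hk] using h ⟨k, hk⟩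
    · simp only [dif_neg hk, le_refl]
  exact hle

theorem finNorm_abs (t : Fin n → ℝ) : Y.finNorm n (fun j => |t j|) = Y.finNorm n t :=
  le_antisymm (Y.finNorm_mono fun j => by rw [abs_abs]) (Y.finNorm_mono fun j => by rw [abs_abs])

theorem finNorm_single_pos (j : Fin n) : 0 < Y.finNorm n (Pi.single j 1) := by
  refine (Y.finNorm_nonneg n _).lt_of_ne' fun h => ?_
  have h1 : extendByZero n (Pi.single j 1) = 0 :=
    congrArg Subtype.val ((Y.isBanachNorm.eq_zero_iff _).1 h)
  have h2 := congrFun h1 (j : ℕ)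
  simp [extendByZero] at h2

theorem mul_finNorm_single_le (t : Fin n → ℝ) (j : Fin n) :
    Y.finNorm n (Pi.single j 1) * |t j| ≤ Y.finNorm n t := by
  rw [mul_comm, ← Y.finNorm_smul]
  refine Y.finNorm_mono fun k => ?_
  rcases eq_or_ne k j with rfl | hk
  · simp
  · simp [hk]

theorem finNorm_le_sum (t : Fin n → ℝ) :
    Y.finNorm n t ≤ ∑ j, Y.finNorm n (Pi.single j 1) * |t j| := by
  have h0 : Y.finNorm n 0 = 0 := by simpa using Y.finNorm_smul n 0 0
  have h : t = ∑ j, t j • (Pi.single j 1 : Fin n → ℝ) := pi_eq_sum_univ' t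
  calc Y.finNorm n t = Y.finNorm n (∑ j, t j • (Pi.single j 1 : Fin n → ℝ)) := by rw [← h]
    _ ≤ ∑ j, Y.finNorm n (t j • (Pi.single j 1 : Fin n → ℝ)) :=
        Finset.le_sum_of_subadditive _ h0.le (Y.finNorm_add_le n) _ _
    _ = ∑ j, Y.finNorm n (Pi.single j 1) * |t j| := by
        simp only [Y.finNorm_smul, mul_comm]

end BanachSequenceLattice

/-! ### Functions equivalent to the `ℓ¹`-norm -/

section NormEquivalence

theorem NormEquivalent.symm {V : Type*} {N M : V → ℝ} (h : NormEquivalent N M) :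
    NormEquivalent M N := by
  obtain ⟨c, C, hc, hC, h⟩ := h
  refine ⟨C⁻¹, c⁻¹, inv_pos.2 hC, inv_pos.2 hc, fun v => ⟨?_, ?_⟩⟩
  · rw [inv_mul_le_iff₀ hC]
    exact (h v).2
  · rw [le_inv_mul_iff₀ hc]
    exact (h v).1

theorem NormEquivalent.trans {V : Type*} {N M P : V → ℝ} (h : NormEquivalent N M)
    (h' : NormEquivalent M P) : NormEquivalent N P := by
  obtain ⟨c, C, hc, hC, h⟩ := h
  obtain ⟨d, D, hd, hD, h'⟩ := h'
  refine ⟨c * d, C * D, mul_pos hc hd, mul_pos hC hD, fun v => ⟨?_, ?_⟩⟩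
  · rw [mul_assoc]
    exact (mul_le_mul_of_nonneg_left (h' v).1 hc.le).trans (h v).1
  · rw [mul_assoc]
    exact (h v).2.trans (mul_le_mul_of_nonneg_left (h' v).2 hC.le)

theorem ellOneNorm_nonneg {X : Type*} [NormedAddCommGroup X] {n : ℕ} (x : Fin n → X) :
    0 ≤ ellOneNorm x := Finset.sum_nonneg fun _ _ => norm_nonneg _

theorem norm_le_ellOneNorm {X : Type*} [NormedAddCommGroup X] {n : ℕ} (x : Fin n → X)
    (j : Fin n) : ‖x j‖ ≤ ellOneNorm x :=
  Finset.single_le_sum (f := fun j => ‖x j‖) (fun _ _ => norm_nonneg _) (Finset.mem_univ j)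

theorem normEquivalent_ellOneNorm {X : Type*} [NormedAddCommGroup X] {n : ℕ}
    {N : (Fin n → X) → ℝ} {w : Fin n → ℝ} (hw : ∀ j, 0 < w j)
    (hle : ∀ x j, w j * ‖x j‖ ≤ N x) (hN : ∀ x, N x ≤ ∑ j, w j * ‖x j‖) (h0 : ∀ x, 0 ≤ N x) :
    NormEquivalent N ellOneNorm := by
  have hsum : 0 ≤ ∑ j, w j := Finset.sum_nonneg fun j _ => (hw j).le
  have hsum' : 0 ≤ ∑ j, (w j)⁻¹ := Finset.sum_nonneg fun j _ => (inv_pos.2 (hw j)).le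
  -- the summand `1` keeps the constants positive for `n = 0`
  refine ⟨(1 + ∑ j, (w j)⁻¹)⁻¹, 1 + ∑ j, w j, by positivity, by positivity,
    fun x => ⟨?_, ?_⟩⟩
  · rw [inv_mul_le_iff₀ (by positivity)]
    have h1 : ellOneNorm x ≤ (∑ j, (w j)⁻¹) * N x := by
      rw [Finset.sum_mul]
      refine Finset.sum_le_sum fun j _ => ?_
      rw [le_inv_mul_iff₀ (hw j)]
      exact hle x j
    linarith [h0 x]
  · have h1 : ∑ j, w j * ‖x j‖ ≤ (∑ j, w j) * ellOneNorm x := by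
      rw [Finset.sum_mul]
      exact Finset.sum_le_sum fun j _ =>
        mul_le_mul_of_nonneg_left (norm_le_ellOneNorm x j) (hw j).le
    linarith [hN x, ellOneNorm_nonneg x]

/-- Completeness of `Xⁿ` passes from the `ℓ¹`-norm to every equivalent function. -/
theorem NormEquivalent.exists_limit {X : Type*} [NormedAddCommGroup X] [CompleteSpace X] {n : ℕ}
    {N : (Fin n → X) → ℝ} (h : NormEquivalent N ellOneNorm) (u : ℕ → Fin n → X)
    (hu : ∀ ε > 0, ∃ K, ∀ m ≥ K, ∀ k ≥ K, N (u m - u k) < ε) :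
    ∃ v, ∀ ε > 0, ∃ K, ∀ m ≥ K, N (u m - v) < ε := by
  obtain ⟨c, C, hc, hC, h⟩ := h
  have hcauchy : ∀ j, CauchySeq fun m => u m j := by
    intro j
    rw [Metric.cauchySeq_iff]
    intro ε hε
    obtain ⟨K, hK⟩ := hu (c * ε) (mul_pos hc hε)
    refine ⟨K, fun m hm k hk => ?_⟩
    rw [dist_eq_norm]
    have h1 := (norm_le_ellOneNorm (u m - u k) j)
    have h2 := ((h (u m - u k)).1.trans_lt (hK m hm k hk))
    exact h1.trans_lt (lt_of_mul_lt_mul_left h2 hc.le)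
  choose v hv using fun j => cauchySeq_tendsto_of_complete (hcauchy j)
  refine ⟨v, fun ε hε => ?_⟩
  have hlim : Filter.Tendsto (fun m => C * ellOneNorm (u m - v)) Filter.atTop (nhds 0) := by
    have h1 : Filter.Tendsto (fun m => ∑ j, ‖u m j - v j‖) Filter.atTop
        (nhds (∑ _j : Fin n, 0)) :=
      tendsto_finsetSum _ fun j _ => tendsto_iff_norm_sub_tendsto_zero.1 (hv j)
    simpa [ellOneNorm] using h1.const_mul C
  obtain ⟨K, hK⟩ := Filter.eventually_atTop.1 (hlim.eventually (gt_mem_nhds hε))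
  exact ⟨K, fun m hm => (h _).2.trans_lt (hK m hm)⟩

end NormEquivalence

/-! ### The norms on `Xⁿ` -/

section TauNorm

theorem norm_le_norm_of_nonneg_of_le {X : Type*} [NormedAddCommGroup X] [Lattice X]
    [IsOrderedAddMonoid X] [HasSolidNorm X] {u v : X} (hu : 0 ≤ u) (huv : u ≤ v) : ‖u‖ ≤ ‖v‖ :=
  norm_le_norm_of_abs_le_abs (by rwa [abs_of_nonneg hu, abs_of_nonneg (hu.trans huv)])

theorem normEquivalent_seqNorm_ellOneNorm (Y : BanachSequenceLattice) {X : Type*}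
    [NormedAddCommGroup X] (n : ℕ) :
    NormEquivalent (seqNorm Y : (Fin n → X) → ℝ) ellOneNorm :=
  normEquivalent_ellOneNorm Y.finNorm_single_pos
    (fun x j => by simpa [seqNorm] using Y.mul_finNorm_single_le (fun j => ‖x j‖) j)
    (fun x => by simpa [seqNorm] using Y.finNorm_le_sum fun j => ‖x j‖)
    fun _ => Y.finNorm_nonneg n _

variable {X : Type*} [NormedAddCommGroup X] [Lattice X] [IsOrderedAddMonoid X]
    [HasSolidNorm X] [NormedSpace ℝ X] [IsOrderedModule ℝ X] [CompleteSpace X]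
    (Y : BanachSequenceLattice) {n : ℕ}

theorem krivine_normHomFun_nonneg (x : Fin n → X) : 0 ≤ krivine x (Y.normHomFun n) :=
  (isKrivineCalculus_krivine x).map_nonneg (Y.finNorm_nonneg n)

theorem mul_norm_le_tauNorm (x : Fin n → X) (j : Fin n) :
    Y.finNorm n (Pi.single j 1) * ‖x j‖ ≤ tauNorm Y x := by
  have hτ := isKrivineCalculus_krivine x
  have hw := (Y.finNorm_single_pos j).le
  have h := hτ.mono (f := Y.finNorm n (Pi.single j 1) • HomFun.modulus (HomFun.proj j))
    (h := Y.normHomFun n) fun t => Y.mul_finNorm_single_le t j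
  rw [map_smul, hτ.map_modulus, hτ.map_proj] at h
  have h1 := norm_le_norm_of_nonneg_of_le (smul_nonneg hw (abs_nonneg _)) h
  rwa [norm_smul_of_nonneg hw, norm_abs_eq_norm] at h1

theorem tauNorm_le_sum (x : Fin n → X) :
    tauNorm Y x ≤ ∑ j, Y.finNorm n (Pi.single j 1) * ‖x j‖ := by
  have hτ := isKrivineCalculus_krivine x
  have h := hτ.mono (f := Y.normHomFun n)
    (h := ∑ j, Y.finNorm n (Pi.single j 1) • HomFun.modulus (HomFun.proj j)) fun t => by
      have h1 := Y.finNorm_le_sum t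
      change Y.finNorm n t ≤ _
      simpa [HomFun.modulus_apply, HomFun.proj] using h1
  rw [map_sum] at h
  simp only [map_smul, hτ.map_modulus, hτ.map_proj] at h
  refine (norm_le_norm_of_nonneg_of_le (krivine_normHomFun_nonneg Y x) h).trans
    ((norm_sum_le _ _).trans_eq (Finset.sum_congr rfl fun j _ => ?_))
  rw [norm_smul_of_nonneg (Y.finNorm_single_pos j).le, norm_abs_eq_norm]

theorem normEquivalent_tauNorm_ellOneNorm (n : ℕ) :
    NormEquivalent (tauNorm Y : (Fin n → X) → ℝ) ellOneNorm :=
  normEquivalent_ellOneNorm Y.finNorm_single_pos (mul_norm_le_tauNorm Y) (tauNorm_le_sum Y)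
    fun _ => norm_nonneg _

theorem tauNorm_smul (c : ℝ) (x : Fin n → X) : tauNorm Y (c • x) = |c| * tauNorm Y x := by
  have hτ := isKrivineCalculus_krivine x
  have h : HomFun.subst (fun j => c • HomFun.proj j) (Y.normHomFun n) = |c| • Y.normHomFun n :=
    Subtype.ext (funext fun t => Y.finNorm_smul n c t)
  have h1 := krivine_subst x (fun j => c • HomFun.proj j) (Y.normHomFun n)
  rw [h, map_smul] at h1
  simp only [map_smul, hτ.map_proj] at h1
  rw [tauNorm, tauNorm, ← Real.norm_eq_abs, ← norm_norm c, ← norm_smul, Real.norm_eq_abs c, h1]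
  rfl

/-- The triangle inequality in `Y`, read as an inequality between functions of `2n` variables,
gives the triangle inequality for `tauNorm Y`. -/
theorem tauNorm_add_le (u v : Fin n → X) : tauNorm Y (u + v) ≤ tauNorm Y u + tauNorm Y v := by
  have hτ := isKrivineCalculus_krivine (Fin.append u v)
  have hadd := krivine_subst (Fin.append u v)
    (fun j => HomFun.proj (Fin.castAdd n j) + HomFun.proj (Fin.natAdd n j)) (Y.normHomFun n)
  simp only [map_add, hτ.map_proj, Fin.append_left, Fin.append_right] at hadd
  have h := hτ.mono
    (f := HomFun.subst (fun j => HomFun.proj (Fin.castAdd n j) + HomFun.proj (Fin.natAdd n j))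
      (Y.normHomFun n))
    (h := HomFun.subst (fun j => HomFun.proj (Fin.castAdd n j)) (Y.normHomFun n) +
      HomFun.subst (fun j => HomFun.proj (Fin.natAdd n j)) (Y.normHomFun n))
    fun t => Y.finNorm_add_le n (fun j => t (Fin.castAdd n j)) fun j => t (Fin.natAdd n j)
  rw [hadd, map_add, krivine_append_left, krivine_append_right] at h
  exact (norm_le_norm_of_nonneg_of_le (krivine_normHomFun_nonneg Y (u + v)) h).trans
    (norm_add_le _ _)

theorem krivine_abs_normHomFun (x : Fin n → X) :
    krivine (fun j => |x j|) (Y.normHomFun n) = krivine x (Y.normHomFun n) := by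
  have hτ := isKrivineCalculus_krivine x
  have h : HomFun.subst (fun j => HomFun.modulus (HomFun.proj j)) (Y.normHomFun n) =
      Y.normHomFun n :=
    Subtype.ext (funext fun t => Y.finNorm_abs t)
  have h1 := krivine_subst x (fun j => HomFun.modulus (HomFun.proj j)) (Y.normHomFun n)
  simp only [hτ.map_modulus, hτ.map_proj, h] at h1
  exact h1.symm

/-- Monotonicity follows from the inequality `‖s‖ ≤ ‖|s| ⊔ |t|‖` between functions of `2n`
variables, because `|u| ⊔ |v| = |v|`. -/
theorem tauNorm_mono {u v : Fin n → X} (huv : |u| ≤ |v|) : tauNorm Y u ≤ tauNorm Y v := by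
  have hτ := isKrivineCalculus_krivine (Fin.append u v)
  have hsup := krivine_subst (Fin.append u v)
    (fun j => HomFun.sup (HomFun.modulus (HomFun.proj (Fin.castAdd n j)))
      (HomFun.modulus (HomFun.proj (Fin.natAdd n j))))
    (Y.normHomFun n)
  have huv' : ∀ j, |u j| ⊔ |v j| = |v j| := fun j => sup_eq_right.2 (huv j)
  simp only [hτ.map_sup, hτ.map_modulus, hτ.map_proj, Fin.append_left, Fin.append_right, huv',
    krivine_abs_normHomFun] at hsup
  have h := hτ.mono
    (f := HomFun.subst (fun j => HomFun.proj (Fin.castAdd n j)) (Y.normHomFun n))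
    (h := HomFun.subst (fun j => HomFun.sup (HomFun.modulus (HomFun.proj (Fin.castAdd n j)))
      (HomFun.modulus (HomFun.proj (Fin.natAdd n j)))) (Y.normHomFun n))
    fun t => Y.finNorm_mono fun j => (le_max_left _ |t (Fin.natAdd n j)|).trans (le_abs_self _)
  rw [hsup, krivine_append_left] at h
  exact norm_le_norm_of_nonneg_of_le (krivine_normHomFun_nonneg Y u) h

theorem isBanachLatticeNorm_tauNorm (n : ℕ) :
    IsBanachLatticeNorm (tauNorm Y : (Fin n → X) → ℝ) where
  nonneg _ := norm_nonneg _
  eq_zero_iff v := by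
    constructor
    · intro h
      funext j
      have h1 := mul_norm_le_tauNorm Y v j
      rw [h] at h1
      have h2 := nonpos_of_mul_nonpos_right h1 (Y.finNorm_single_pos j)
      exact norm_le_zero_iff.1 h2
    · rintro rfl
      simpa using tauNorm_smul Y 0 (0 : Fin n → X)
  smul := tauNorm_smul Y
  add_le := tauNorm_add_le Y
  complete := (normEquivalent_tauNorm_ellOneNorm Y n).exists_limit
  solid _ _ := tauNorm_mono Y

end TauNorm

end

theorem mainTheorem1 {X : Type*} [NormedAddCommGroup X] [Lattice X] [IsOrderedAddMonoid X]
    [HasSolidNorm X] [NormedSpace ℝ X] [IsOrderedModule ℝ X] [CompleteSpace X]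
    (Y : BanachSequenceLattice) (n : ℕ) :
    (∀ x : Fin n → X, IsKrivineCalculus x (krivine x) ∧
      ∀ τ : HomFun n →ₗ[ℝ] X, IsKrivineCalculus x τ → τ = krivine x) ∧
    NormEquivalent (tauNorm Y : (Fin n → X) → ℝ) ellOneNorm ∧
    IsBanachLatticeNorm (tauNorm Y : (Fin n → X) → ℝ) ∧
    NormEquivalent (tauNorm Y : (Fin n → X) → ℝ) (seqNorm Y) :=
  ⟨fun x => ⟨isKrivineCalculus_krivine x, fun _ hτ => hτ.unique (isKrivineCalculus_krivine x)⟩,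
    normEquivalent_tauNorm_ellOneNorm Y n, isBanachLatticeNorm_tauNorm Y n,
    (normEquivalent_tauNorm_ellOneNorm Y n).trans (normEquivalent_seqNorm_ellOneNorm Y n).symm⟩
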